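/- Let $\boldsymbol{x}'=\boldsymbol{f}(\boldsymbol{x},\boldsymbol{\mu},u)$, $\boldsymbol{y}=\boldsymbol{g}(\boldsymbol{x},\boldsymbol{\mu},u)$, $\boldsymbol{x}(0)=\boldsymbol{x}^*$ be an algebraic differential model with states $x_1,\dots,x_n$, outputs $y_1,\dots,y_m$, parameters $\mu_1,\dots,\mu_\lambda$ and one input $u$, where the $f_i$ and $g_k$ are rational functions over $\mathbb{C}$. Let $Q\in\mathbb{C}[\boldsymbol{\mu},\boldsymbol{x},u]$ be the least common multiple of all the denominators of the $f_i$ and $g_k$, and write $f_i=F_i/Q$, $g_k=G_k/Q$. Let $\mathcal{R}=\mathbb{C}[\boldsymbol{\mu}]\{\boldsymbol{x},\boldsymbol{y},u\}$ be the ring of differential polynomials, with $\boldsymbol{\mu}'=0$. For $\boldsymbol{h}\in\mathbb{Z}_{\ge 0}^m$ let $\mathcal{S}_{\boldsymbol{h}}\subset\mathcal{R}$ be the (finite) set obtained as follows: start with all $(Qy_k-G_k)^{(j)}$, $1\le k\le m$, $0\le j<h_k$; then, as long as for some $1\le i\le n$ and $j\ge 1$ the variable $x_i^{(j)}$ appears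 in an element of the set, but $(Qx_i'-F_i)^{(j-1)}$ is not in the set, put $(Qx_i'-F_i)^{(j-1)}$ into the set. For a differential indeterminate $z$ and a polynomial $P$, let $\operatorname{ord}_zP$ be the largest $j$ such that $z^{(j)}$ appears in $P$, and $-1$ if there is none. Put $$\mathrm{State}(\boldsymbol{h})_i=\max_{P\in\mathcal{S}_{\boldsymbol{h}}}\operatorname{ord}_{x_i}P+1,\qquad \mathrm{In}(\boldsymbol{h})=\max_{P\in\mathcal{S}_{\boldsymbol{h}}}\operatorname{ord}_uP+1$$ (both are $0$ if $\mathcal{S}_{\boldsymbol{h}}=\varnothing$), and let $\boldsymbol{y}_{\boldsymbol{h}}=\{y_k^{(j)}: 0\le j<h_k\}$, $\boldsymbol{x}_{\mathrm{State}(\boldsymbol{h})}=\{x_i^{(j)}:0\le j<\mathrm{State}(\boldsymbol{h})_i\}$, $u_{\mathrm{In}(\boldsymbol{h})}=\{u^{(j)}:0\le j<\mathrm{In}(\boldsymbol{h})\}$. Then $\mathcal{S}_{\boldsymbol{h}}$ is contained in $\mathcal{R}_{\boldsymbol{h}}=\mathbb{C}[\boldsymbol{\mu},\boldsymbol{x}_{\mathrm{State}(\boldsymbol{h})},\boldsymbol{y}_{\boldsymbol{h}},u_{\mathrm{In}(\boldsymbol{h})}]$.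 Let $\mathcal{J}_{\boldsymbol{h}}=(\mathcal{S}_{\boldsymbol{h}}):Q^\infty\subset\mathcal{R}_{\boldsymbol{h}}$, and let $Z_{\boldsymbol{h}}$ be the zero set of $\mathcal{J}_{\boldsymbol{h}}$ in the complex affine space with coordinates $(\boldsymbol{\mu},\boldsymbol{x}_{\mathrm{State}(\boldsymbol{h})},\boldsymbol{y}_{\boldsymbol{h}},u_{\mathrm{In}(\boldsymbol{h})})$. Then, for every $\boldsymbol{h}\in\mathbb{Z}_{\ge 0}^m$, the projection of $Z_{\boldsymbol{h}}$ to the affine space with coordinates $(\boldsymbol{y}_{\boldsymbol{h}},u_{\mathrm{In}(\boldsymbol{h})})$ is dominant (that is, its image is Zariski dense) if and only if the rank of the Jacobian matrix of $\mathcal{S}_{\boldsymbol{h}}$ with respect to $(\boldsymbol{\mu},\boldsymbol{x}_{\mathrm{State}(\boldsymbol{h})})$ is equal to $|\mathcal{S}_{\boldsymbol{h}}|$ at every point of some Zariski dense open subset of $Z_{\boldsymbol{h}}$. -/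

import Mathlib

noncomputable section

/-- The variables of the field of rational functions in which the right-hand sides of a model live:
`l` system parameters `μ`, `n` states `x`, and the input `u`. -/
inductive BaseVar (n l : ℕ) : Type
  | mu (a : Fin l)
  | x (i : Fin n)
  | u

/-- The polynomial ring `ℂ[μ, x, u]`. -/
abbrev BasePoly (n l : ℕ) : Type := MvPolynomial (BaseVar n l) ℂ

/-- The field of rational functions `ℂ(μ, x, u)`. -/
abbrev BaseRat (n l : ℕ) : Type := FractionRing (BasePoly n l)

/-- An algebraic differential model `x' = f(x, μ, u)`, `y = g(x, μ, u)`, `x(0) = x*` with `n` states,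
`m` outputs, `l` parameters and one input; `f` and `g` are tuples of rational functions over `ℂ`. -/
structure DiffModel (n m l : ℕ) where
  f : Fin n → BaseRat n l
  g : Fin m → BaseRat n l

/-- The way of writing a model over a common denominator: `Q` is a least common multiple of all the
denominators (of the reduced fractions) of `f` and `g`, and `f i = F i / Q`, `g k = G k / Q`.
A least common multiple, hence all these data, is unique up to a factor in `ℂ \ {0}`. -/
structure LcmForm {n m l : ℕ} (M : DiffModel n m l) where
  Q : BasePoly n l
  F : Fin n → BasePoly n l
  G : Fin m → BasePoly n l
  isLcm : ∀ d : BasePoly n l, Q ∣ d ↔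
    (∀ i, (IsFractionRing.den (BasePoly n l) (M.f i) : BasePoly n l) ∣ d) ∧
    (∀ k, (IsFractionRing.den (BasePoly n l) (M.g k) : BasePoly n l) ∣ d)
  f_eq : ∀ i, M.f i =
    algebraMap (BasePoly n l) (BaseRat n l) (F i) / algebraMap (BasePoly n l) (BaseRat n l) Q
  g_eq : ∀ k, M.g k =
    algebraMap (BasePoly n l) (BaseRat n l) (G k) / algebraMap (BasePoly n l) (BaseRat n l) Q

theorem exists_eq_div_of_den_dvd {n l : ℕ} (r : BaseRat n l) (Q : BasePoly n l) (hQ : Q ≠ 0)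
    (h : (IsFractionRing.den (BasePoly n l) r : BasePoly n l) ∣ Q) :
    ∃ F : BasePoly n l, r =
      algebraMap (BasePoly n l) (BaseRat n l) F / algebraMap (BasePoly n l) (BaseRat n l) Q := by
  obtain ⟨c, rfl⟩ := h
  have hc : c ≠ 0 := right_ne_zero_of_mul hQ
  have hd := left_ne_zero_of_mul hQ
  refine ⟨IsFractionRing.num (BasePoly n l) r * c, ?_⟩
  have hinj := IsFractionRing.injective (BasePoly n l) (BaseRat n l)
  have hc' : algebraMap (BasePoly n l) (BaseRat n l) c ≠ 0 := by
    rwa [Ne, map_eq_zero_iff _ hinj]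
  rw [map_mul, map_mul, mul_div_mul_right _ _ hc', IsFractionRing.mk'_num_den']

/-- Every model can be written over the least common multiple of its denominators. -/
theorem nonempty_lcmForm {n m l : ℕ} (M : DiffModel n m l) : Nonempty (LcmForm M) := by
  classical
  let _ := UniqueFactorizationMonoid.strongNormalizationMonoid (α := BasePoly n l)
  let _ : NormalizedGCDMonoid (BasePoly n l) :=
    UniqueFactorizationMonoid.toNormalizedGCDMonoid (BasePoly n l)
  let df : Fin n → BasePoly n l := fun i => (IsFractionRing.den (BasePoly n l) (M.f i) : BasePoly n l)
  let dg : Fin m → BasePoly n l := fun k => (IsFractionRing.den (BasePoly n l) (M.g k) : BasePoly n l)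
  let Q : BasePoly n l := lcm (Finset.univ.lcm df) (Finset.univ.lcm dg)
  have hQ : ∀ d, Q ∣ d ↔ (∀ i, df i ∣ d) ∧ (∀ k, dg k ∣ d) := by
    intro d
    simp [Q, lcm_dvd_iff, Finset.lcm_dvd_iff]
  have hdf : ∀ i, df i ≠ 0 := fun i => nonZeroDivisors.coe_ne_zero _
  have hdg : ∀ k, dg k ≠ 0 := fun k => nonZeroDivisors.coe_ne_zero _
  have hQ0 : Q ≠ 0 := by
    have hd : Q ∣ (∏ i, df i) * ∏ k, dg k := (hQ _).2
      ⟨fun i => Dvd.dvd.mul_right (Finset.dvd_prod_of_mem df (Finset.mem_univ i)) _,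
        fun k => Dvd.dvd.mul_left (Finset.dvd_prod_of_mem dg (Finset.mem_univ k)) _⟩
    exact ne_zero_of_dvd_ne_zero (mul_ne_zero (Finset.prod_ne_zero_iff.2 fun i _ => hdf i)
      (Finset.prod_ne_zero_iff.2 fun k _ => hdg k)) hd
  obtain ⟨h1, h2⟩ := (hQ Q).1 dvd_rfl
  choose F hF using fun i => exists_eq_div_of_den_dvd (M.f i) Q hQ0 (h1 i)
  choose G hG using fun k => exists_eq_div_of_den_dvd (M.g k) Q hQ0 (h2 k)
  exact ⟨⟨Q, F, G, hQ, hF, hG⟩⟩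

/-- The algebraic indeterminates of the differential ring `ℂ[μ]{x, y, u}`: the parameters, and the
derivatives `x i ^ (j)`, `y k ^ (j)`, `u ^ (j)` for all `j ≥ 0`. -/
inductive DVar (n m l : ℕ) : Type
  | mu (a : Fin l)
  | x (i : Fin n) (j : ℕ)
  | y (k : Fin m) (j : ℕ)
  | u (j : ℕ)

/-- The differential polynomial ring `ℂ[μ]{x, y, u}`. -/
abbrev DPoly (n m l : ℕ) : Type := MvPolynomial (DVar n m l) ℂ

/-- The derivative of an indeterminate; the parameters are constant. -/
def DVar.next {n m l : ℕ} : DVar n m l → DPoly n m l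
  | .mu _ => 0
  | .x i j => MvPolynomial.X (.x i (j + 1))
  | .y k j => MvPolynomial.X (.y k (j + 1))
  | .u j => MvPolynomial.X (.u (j + 1))

/-- The derivation `P ↦ P'` of `ℂ[μ]{x, y, u}`. -/
def dder (n m l : ℕ) : Derivation ℂ (DPoly n m l) (DPoly n m l) :=
  MvPolynomial.mkDerivation ℂ DVar.next

/-- `μ, x, u` as differential indeterminates (of order `0`). -/
def BaseVar.toDVar {n m l : ℕ} : BaseVar n l → DVar n m l
  | .mu a => .mu a
  | .x i => .x i 0
  | .u => .u 0

/-- The inclusion `ℂ[μ, x, u] ⊆ ℂ[μ]{x, y, u}`. -/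
def toDPoly {n m l : ℕ} (p : BasePoly n l) : DPoly n m l := MvPolynomial.rename BaseVar.toDVar p

namespace LcmForm

variable {n m l : ℕ} {M : DiffModel n m l} (L : LcmForm M)

/-- The differential polynomial `(Q y_k - G_k)^(j)`. -/
def outPoly (k : Fin m) (j : ℕ) : DPoly n m l :=
  (dder n m l)^[j] (toDPoly L.Q * MvPolynomial.X (.y k 0) - toDPoly (L.G k))

/-- The differential polynomial `(Q x_i' - F_i)^(j)`. -/
def statePoly (i : Fin n) (j : ℕ) : DPoly n m l :=
  (dder n m l)^[j] (toDPoly L.Q * MvPolynomial.X (.x i 1) - toDPoly (L.F i))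

/-- Membership in the set `S_h`: start with `(Q y_k - G_k)^(j)` for `j < h_k`, and, as long as some
`x_i^(j+1)` appears in an element of the set, put `(Q x_i' - F_i)^(j)` into the set. -/
inductive MemS (h : Fin m → ℕ) : DPoly n m l → Prop
  | output (k : Fin m) (j : ℕ) (hj : j < h k) : MemS h (L.outPoly k j)
  | state (i : Fin n) (j : ℕ) (P : DPoly n m l) (hP : MemS h P) (hx : DVar.x i (j + 1) ∈ P.vars) :
      MemS h (L.statePoly i j)

/-- The set `S_h` as a subset of `ℂ[μ]{x, y, u}`. -/
def S (h : Fin m → ℕ) : Set (DPoly n m l) := {P | L.MemS h P}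

end LcmForm

/-- Indeterminates of order at most `r`, where only the outputs with index in `K` are allowed. -/
def boundedVars (n : ℕ) {m : ℕ} (l : ℕ) (K : Set (Fin m)) (r : ℕ) : Set (DVar n m l) :=
  fun v => match v with
    | .mu _ => True
    | .x _ j => j ≤ r
    | .y k j => k ∈ K ∧ j ≤ r
    | .u j => j ≤ r

theorem dder_mem_supported {n m l : ℕ} (K : Set (Fin m)) (r : ℕ) (p : DPoly n m l)
    (hp : p ∈ MvPolynomial.supported ℂ (boundedVars n l K r)) :
    dder n m l p ∈ MvPolynomial.supported ℂ (boundedVars n l K (r + 1)) := by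
  have hmono : boundedVars n l K r ⊆ boundedVars n l K (r + 1) := by
    rintro (a | ⟨i, j⟩ | ⟨k, j⟩ | j) hv
    · trivial
    · exact Nat.le_succ_of_le hv
    · exact ⟨hv.1, Nat.le_succ_of_le hv.2⟩
    · exact Nat.le_succ_of_le hv
  have hle := MvPolynomial.supported_mono (R := ℂ) hmono
  induction hp using Algebra.adjoin_induction with
  | mem q hq =>
    obtain ⟨v, hv, rfl⟩ := hq
    rw [dder, MvPolynomial.mkDerivation_X]
    rcases v with a | ⟨i, j⟩ | ⟨k, j⟩ | j
    · exact Subalgebra.zero_mem _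
    · exact (MvPolynomial.X_mem_supported).2 (Nat.succ_le_succ hv)
    · exact (MvPolynomial.X_mem_supported).2 ⟨hv.1, Nat.succ_le_succ hv.2⟩
    · exact (MvPolynomial.X_mem_supported).2 (Nat.succ_le_succ hv)
  | algebraMap c => rw [Derivation.map_algebraMap]; exact Subalgebra.zero_mem _
  | add p q _ _ h1 h2 => rw [map_add]; exact Subalgebra.add_mem _ h1 h2
  | mul p q hp hq h1 h2 =>
    rw [Derivation.leibniz]
    exact Subalgebra.add_mem _ (Subalgebra.mul_mem _ (hle hp) h2)
      (Subalgebra.mul_mem _ (hle hq) h1)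

theorem iterate_dder_mem_supported {n m l : ℕ} (K : Set (Fin m)) (r : ℕ) (p : DPoly n m l)
    (hp : p ∈ MvPolynomial.supported ℂ (boundedVars n l K r)) (j : ℕ) :
    (dder n m l)^[j] p ∈ MvPolynomial.supported ℂ (boundedVars n l K (r + j)) := by
  induction j with
  | zero => exact hp
  | succ j ih =>
    rw [Function.iterate_succ_apply']
    exact dder_mem_supported K (r + j) _ ih

theorem toDPoly_mem_supported {n m l : ℕ} (K : Set (Fin m)) (r : ℕ) (p : BasePoly n l) :
    (toDPoly p : DPoly n m l) ∈ MvPolynomial.supported ℂ (boundedVars n l K r) := by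
  rw [MvPolynomial.mem_supported]
  intro v hv
  obtain ⟨w, -, rfl⟩ := MvPolynomial.mem_vars_rename _ _ hv
  rcases w with a | i | _
  · trivial
  · exact Nat.zero_le _
  · exact Nat.zero_le _

namespace LcmForm

variable {n m l : ℕ} {M : DiffModel n m l} (L : LcmForm M)

theorem outPoly_vars (k : Fin m) (j : ℕ) :
    ((L.outPoly k j).vars : Set (DVar n m l)) ⊆ boundedVars n l {k} j := by
  rw [← MvPolynomial.mem_supported (R := ℂ)]
  have hk : (DVar.y k 0 : DVar n m l) ∈ boundedVars n l {k} 0 := ⟨rfl, le_rfl⟩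
  have := iterate_dder_mem_supported (n := n) (l := l) {k} 0
    (toDPoly L.Q * MvPolynomial.X (.y k 0) - toDPoly (L.G k))
    (Subalgebra.sub_mem _ (Subalgebra.mul_mem _ (toDPoly_mem_supported _ _ _)
      (MvPolynomial.X_mem_supported.2 hk)) (toDPoly_mem_supported _ _ _)) j
  rwa [Nat.zero_add] at this

theorem statePoly_vars (i : Fin n) (j : ℕ) :
    ((L.statePoly i j).vars : Set (DVar n m l)) ⊆ boundedVars n l ∅ (j + 1) := by
  rw [← MvPolynomial.mem_supported (R := ℂ)]
  have := iterate_dder_mem_supported (n := n) (l := l) (∅ : Set (Fin m)) 1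
    (toDPoly L.Q * MvPolynomial.X (.x i 1) - toDPoly (L.F i))
    (Subalgebra.sub_mem _ (Subalgebra.mul_mem _ (toDPoly_mem_supported _ _ _)
      (MvPolynomial.X_mem_supported.2 (le_refl 1))) (toDPoly_mem_supported _ _ _)) j
  rwa [Nat.add_comm] at this

theorem memS_cases (h : Fin m → ℕ) {P : DPoly n m l} (hP : L.MemS h P) :
    (∃ k j, j < h k ∧ P = L.outPoly k j) ∨
      (∃ i j, j + 1 < Finset.univ.sup h ∧ P = L.statePoly i j) := by
  induction hP with
  | output k j hj => exact Or.inl ⟨k, j, hj, rfl⟩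
  | state i j P _ hx ih =>
    refine Or.inr ⟨i, j, ?_, rfl⟩
    rcases ih with ⟨k, j', hj', rfl⟩ | ⟨i', j', hj', rfl⟩
    · have h1 : j + 1 ≤ j' := L.outPoly_vars k j' hx
      exact lt_of_le_of_lt h1 (lt_of_lt_of_le hj' (Finset.le_sup (f := h) (Finset.mem_univ k)))
    · have h1 : j + 1 ≤ j' + 1 := L.statePoly_vars i' j' hx
      exact lt_of_le_of_lt h1 hj'

theorem S_finite (h : Fin m → ℕ) : (L.S h).Finite := by
  refine Set.Finite.subset (((Set.finite_univ (α := Fin m)).prod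
    (Set.finite_lt_nat (Finset.univ.sup h))).image (fun a => L.outPoly a.1 a.2) |>.union
    (((Set.finite_univ (α := Fin n)).prod
    (Set.finite_lt_nat (Finset.univ.sup h))).image (fun a => L.statePoly a.1 a.2))) ?_
  intro P hP
  rcases L.memS_cases h hP with ⟨k, j, hj, rfl⟩ | ⟨i, j, hj, rfl⟩
  · exact Or.inl ⟨(k, j), ⟨trivial, lt_of_lt_of_le hj (Finset.le_sup (f := h) (Finset.mem_univ k))⟩, rfl⟩
  · exact Or.inr ⟨(i, j), ⟨trivial, lt_trans (Nat.lt_succ_self j) hj⟩, rfl⟩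

/-- `ord_{x_i} P + 1`, where `ord_{x_i} P` is the largest `j` such that `x_i^(j)` appears in `P`, and
`-1` if there is none. -/
def _root_.ordXSucc (i : Fin n) (P : DPoly n m l) : ℕ :=
  P.vars.sup fun v => match v with
    | .x i' j => if i' = i then j + 1 else 0
    | _ => 0

/-- `ord_u P + 1`, where `ord_u P` is the largest `j` such that `u^(j)` appears in `P`, and `-1` if
there is none. -/
def _root_.ordUSucc (P : DPoly n m l) : ℕ :=
  P.vars.sup fun v => match v with
    | .u j => j + 1
    | _ => 0

/-- `State(h)_i`, the maximum of `ord_{x_i} P + 1` over `P ∈ S_h` (`0` if `S_h` is empty). -/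
def State (h : Fin m → ℕ) (i : Fin n) : ℕ := (L.S_finite h).toFinset.sup (ordXSucc i)

/-- `In(h)`, the maximum of `ord_u P + 1` over `P ∈ S_h` (`0` if `S_h` is empty). -/
def In (h : Fin m → ℕ) : ℕ := (L.S_finite h).toFinset.sup ordUSucc

/-- Indices of the coordinates `(μ, x_{State(h)})`. -/
abbrev ParState (h : Fin m → ℕ) : Type := Fin l ⊕ (Σ i : Fin n, Fin (L.State h i))

/-- Indices of the coordinates `(y_h, u_{In(h)})`. -/
abbrev OutInput (h : Fin m → ℕ) : Type := (Σ k : Fin m, Fin (h k)) ⊕ Fin (L.In h)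

/-- Indices of the coordinates `(μ, x_{State(h)}, y_h, u_{In(h)})`. -/
abbrev Coord (h : Fin m → ℕ) : Type := L.ParState h ⊕ L.OutInput h

/-- The indeterminate of `ℂ[μ]{x, y, u}` with a given index. -/
def Coord.toDVar (h : Fin m → ℕ) : L.Coord h → DVar n m l
  | .inl (.inl a) => .mu a
  | .inl (.inr ⟨i, j⟩) => .x i j
  | .inr (.inl ⟨k, j⟩) => .y k j
  | .inr (.inr j) => .u j

/-- The polynomial ring `R_h = ℂ[μ, x_{State(h)}, y_h, u_{In(h)}]`. -/
abbrev R (h : Fin m → ℕ) : Type := MvPolynomial (L.Coord h) ℂ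

/-- The inclusion `R_h ⊆ ℂ[μ]{x, y, u}`. -/
def incl (h : Fin m → ℕ) : L.R h →ₐ[ℂ] DPoly n m l := MvPolynomial.rename (Coord.toDVar L h)

/-- The set `S_h` as a subset of `R_h`. -/
def SR (h : Fin m → ℕ) : Set (L.R h) := L.incl h ⁻¹' L.S h

theorem Coord.toDVar_injective (h : Fin m → ℕ) : Function.Injective (Coord.toDVar L h) := by
  rintro ((a | ⟨i, j⟩) | (⟨k, j⟩ | j)) ((a' | ⟨i', j'⟩) | (⟨k', j'⟩ | j')) hv <;>
    simp only [Coord.toDVar, DVar.mu.injEq, DVar.x.injEq, DVar.y.injEq, DVar.u.injEq,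
      reduceCtorEq] at hv
  · rw [hv]
  · obtain ⟨rfl, hj⟩ := hv
    rw [Fin.ext hj]
  · obtain ⟨rfl, hj⟩ := hv
    rw [Fin.ext hj]
  · rw [Fin.ext hv]

/-- `S_h` is contained in `R_h`. -/
theorem S_subset_range (h : Fin m → ℕ) : L.S h ⊆ Set.range (L.incl h) := by
  intro P hP
  have hmem : P ∈ (L.S_finite h).toFinset := (L.S_finite h).mem_toFinset.2 hP
  have hv : (P.vars : Set (DVar n m l)) ⊆ Set.range (Coord.toDVar L h) := by
    rintro (a | ⟨i, j⟩ | ⟨k, j⟩ | j) hv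
    · exact ⟨.inl (.inl a), rfl⟩
    · have h1 : j + 1 ≤ ordXSucc i P := by
        refine le_trans ?_ (Finset.le_sup (f := fun v : DVar n m l => match v with
          | .x i' j => if i' = i then j + 1 else 0
          | _ => 0) (Finset.mem_coe.1 hv))
        simp
      have h2 : j < L.State h i := le_trans h1 (Finset.le_sup (f := ordXSucc i) hmem)
      exact ⟨.inl (.inr ⟨i, ⟨j, h2⟩⟩), rfl⟩
    · have h2 : j < h k := by
        rcases L.memS_cases h hP with ⟨k', j', hj', rfl⟩ | ⟨i', j', _, rfl⟩
        · obtain ⟨hk, hj⟩ := L.outPoly_vars k' j' hv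
          obtain rfl : k = k' := hk
          exact lt_of_le_of_lt hj hj'
        · exact absurd (L.statePoly_vars i' j' hv).1 (Set.notMem_empty _)
      exact ⟨.inr (.inl ⟨k, ⟨j, h2⟩⟩), rfl⟩
    · have h1 : j + 1 ≤ ordUSucc P :=
        Finset.le_sup (f := fun v : DVar n m l => match v with
          | .u j => j + 1
          | _ => 0) (Finset.mem_coe.1 hv)
      have h2 : j < L.In h := le_trans h1 (Finset.le_sup (f := ordUSucc) hmem)
      exact ⟨.inr (.inr ⟨j, h2⟩), rfl⟩
  exact MvPolynomial.exists_rename_eq_of_vars_subset_range P _ (Coord.toDVar_injective L h) hv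

theorem image_SR (h : Fin m → ℕ) : L.incl h '' L.SR h = L.S h :=
  Set.image_preimage_eq_of_subset (L.S_subset_range h)

/-- The ideal `J_h = (S_h) : Q^∞` of `R_h`. The products `Q ^ N * r` are formed in
`ℂ[μ]{x, y, u}`, because `Q` need not lie in `R_h` if `h = 0`; if `Q ∈ R_h`, this is the same as
`Q ^ N * r` lying in the ideal of `R_h` generated by `S_h`. -/
def J (h : Fin m → ℕ) : Ideal (L.R h) where
  carrier := {r | ∃ N : ℕ, toDPoly L.Q ^ N * L.incl h r ∈ Ideal.span (L.S h)}
  zero_mem' := ⟨0, by simp⟩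
  add_mem' := by
    rintro a b ⟨N, hN⟩ ⟨N', hN'⟩
    refine ⟨N + N', ?_⟩
    have h1 := Ideal.mul_mem_left _ (toDPoly L.Q ^ N') hN
    have h2 := Ideal.mul_mem_left _ (toDPoly L.Q ^ N) hN'
    have h3 := Ideal.add_mem _ h1 h2
    rw [map_add]
    convert h3 using 1
    ring
  smul_mem' := by
    rintro c a ⟨N, hN⟩
    refine ⟨N, ?_⟩
    rw [smul_eq_mul, map_mul, mul_left_comm]
    exact Ideal.mul_mem_left _ _ hN

/-- The zero set `Z_h` of `J_h` in the affine space with coordinates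
`(μ, x_{State(h)}, y_h, u_{In(h)})`. -/
def Z (h : Fin m → ℕ) : Set (L.Coord h → ℂ) := MvPolynomial.zeroLocus ℂ (L.J h)

/-- The projection to the `(y_h, u_{In(h)})`-coordinates. -/
def proj (h : Fin m → ℕ) (p : L.Coord h → ℂ) : L.OutInput h → ℂ := fun v => p (Sum.inr v)

/-- The Jacobian matrix of `S_h` with respect to `(μ, x_{State(h)})` at a point. -/
def jacobian (h : Fin m → ℕ) (p : L.Coord h → ℂ) : Matrix (L.SR h) (L.ParState h) ℂ :=
  Matrix.of fun P v => MvPolynomial.eval p (MvPolynomial.pderiv (Sum.inl v) (P : L.R h))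

end LcmForm

/-- The Zariski topology on the affine space `ℂ^σ`: closed sets are the zero sets of ideals of
polynomials. -/
@[reducible]
def zariski (σ : Type) : TopologicalSpace (σ → ℂ) :=
  TopologicalSpace.ofClosed
    {A | ∃ I : Ideal (MvPolynomial σ ℂ), A = MvPolynomial.zeroLocus ℂ I}
    ⟨⊤, by simp⟩
    (by
      intro 𝒜 h𝒜
      choose I hI using fun (A : Set (σ → ℂ)) (hA : A ∈ 𝒜) => h𝒜 hA
      refine ⟨⨆ (A) (hA : A ∈ 𝒜), I A hA, ?_⟩
      apply Set.Subset.antisymm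
      · refine (MvPolynomial.le_zeroLocus_iff_le_vanishingIdeal (K := ℂ)).2 (iSup₂_le fun A hA => ?_)
        refine (MvPolynomial.le_zeroLocus_iff_le_vanishingIdeal (K := ℂ)).1 ?_
        exact (Set.sInter_subset_of_mem hA).trans (hI A hA).subset
      · refine Set.subset_sInter fun A hA => ?_
        rw [hI A hA]
        exact MvPolynomial.zeroLocus_anti_mono (le_iSup₂_of_le A hA le_rfl))
    (by
      rintro _ ⟨I, rfl⟩ _ ⟨I', rfl⟩
      refine ⟨I * I', ?_⟩
      apply Set.Subset.antisymm
      · refine Set.union_subset ?_ ?_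
        · exact MvPolynomial.zeroLocus_anti_mono Ideal.mul_le_left
        · exact MvPolynomial.zeroLocus_anti_mono Ideal.mul_le_right
      · intro p hp
        by_contra hc
        rw [Set.mem_union, not_or, MvPolynomial.mem_zeroLocus_iff,
          MvPolynomial.mem_zeroLocus_iff] at hc
        obtain ⟨h1, h2⟩ := hc
        push Not at h1 h2
        obtain ⟨a, ha, ha'⟩ := h1
        obtain ⟨b, hb, hb'⟩ := h2
        have hab := hp (a * b) (Ideal.mul_mem_mul ha hb)
        rw [map_mul] at hab
        exact (mul_ne_zero ha' hb') hab)

namespace LcmForm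

variable {n m l : ℕ} {M : DiffModel n m l} (L : LcmForm M)

/-- The projection of `Z_h` to the `(y_h, u_{In(h)})`-coordinates is dominant: its image is Zariski
dense in the affine space with these coordinates. -/
def ProjDominant (h : Fin m → ℕ) : Prop :=
  @Dense (L.OutInput h → ℂ) (zariski (L.OutInput h)) (L.proj h '' L.Z h)

/-- The Jacobian of `S_h` with respect to `(μ, x_{State(h)})` has rank `|S_h|` on a (Zariski) dense
open subset of `Z_h`. -/
def JacobianFullRank (h : Fin m → ℕ) : Prop :=
  ∃ U : Set (L.Coord h → ℂ), @IsOpen _ (zariski (L.Coord h)) U ∧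
    L.Z h ⊆ @closure _ (zariski (L.Coord h)) (U ∩ L.Z h) ∧
    ∀ p ∈ U ∩ L.Z h, (L.jacobian h p).rank = (L.S h).ncard

end LcmForm

end

/-!
The system `S_h` is triangular: for the ranking in which `y k ^ (j)` dominates `x i ^ (j)` and higher
derivatives dominate lower ones, each of its elements is `Q * X v - B`, where `B` only involves
indeterminates of smaller rank than the leader `v`, the leaders are distinct, and none of them occurs
in `Q`. Solving for the leaders expresses them as rational functions of the remaining
indeterminates, which stay free. The resulting homomorphism `φ` to a field `K` has kernel
`(S_h) : Q^∞` (`MvPolynomial.IsTriangular.exists_genericPoint`). Hence `J_h` is prime, `Z_h` is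
irreducible with generic point `φ`, and by the Nullstellensatz

* the projection is dominant iff the images of `(y_h, u_{In(h)})` in `K` are algebraically
  independent over `ℂ` (`LcmForm.projDominant_iff`);
* the Jacobian has rank `|S_h|` on a dense open subset iff some maximal minor is nonzero in `K`, that
  is, iff the Jacobian at `φ` has full row rank (`LcmForm.jacobianFullRank_iff`).

These two conditions on `φ` are compared by the Jacobian criterion
`MvPolynomial.IsTriangular.algebraicIndependent_iff_rank_jacobian`. Derivations are encoded by
homomorphisms to the dual numbers `K[ε]`. If the Jacobian has full row rank, each vector of values on
`(y_h, u_{In(h)})` extends to a tangent vector of `S_h` at `φ`, so the ideal of algebraic relations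
between these coordinates is stable under partial derivatives, and therefore zero in characteristic
zero. Conversely, if these coordinates are algebraically independent, `K` is formally smooth over the
polynomial ring that they generate, so derivations of `K` take arbitrary values on them
(`AlgebraicIndependent.exists_algHom_dualNumber`). A linear relation between the rows of the Jacobian
with respect to `(μ, x_{State(h)})` is then a relation between the rows of the full Jacobian, which
are independent by triangularity.
-/

open scoped DualNumber

/-! ### Derivations and dual numbers -/

namespace MvPolynomial

/-- Chain rule for a homomorphism to the dual numbers. -/
theorem snd_algHom_dualNumber {τ k K : Type*} [Fintype τ] [Field k] [Field K] [Algebra k K]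
    (φ : MvPolynomial τ k →ₐ[k] K) (Ψ : MvPolynomial τ k →ₐ[k] K[ε])
    (h : ∀ p, (Ψ p).fst = φ p) (p : MvPolynomial τ k) :
    (Ψ p).snd = ∑ v, φ (pderiv v p) * (Ψ (X v)).snd := by
  classical
  induction p using MvPolynomial.induction_on with
  | C a =>
    have : Ψ (C a) = algebraMap k K[ε] a := Ψ.commutes a
    rw [this]
    simp [TrivSqZeroExt.algebraMap_eq_inl']
  | add p q hp hq => simp [hp, hq, add_mul, Finset.sum_add_distrib]
  | mul_X p w ih =>
    rw [map_mul, DualNumber.snd_mul, ih, h, h]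
    simp only [pderiv_mul, pderiv_X, map_add, map_mul, add_mul, Finset.sum_add_distrib,
      Pi.single_apply]
    rw [add_comm, Finset.sum_mul]
    congr 1
    · exact Finset.sum_congr rfl fun v _ => by ring
    · simp [apply_ite φ]

/-- In characteristic zero, a polynomial all of whose partial derivatives vanish is constant. -/
theorem eq_C_of_forall_pderiv_eq_zero {τ k : Type*} [Field k] [CharZero k]
    (p : MvPolynomial τ k) (h : ∀ v, pderiv v p = 0) : p = C (p.coeff 0) := by
  classical
  ext s
  rw [coeff_C]
  split_ifs with hs
  · rw [hs]
  · obtain ⟨v, hv⟩ : ∃ v, s v ≠ 0 := by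
      by_contra! H
      exact hs (Finsupp.ext fun v => (H v).symm)
    have h1 := congrArg (coeff (s - Finsupp.single v 1)) (h v)
    rw [coeff_pderiv, coeff_zero] at h1
    have h2 : s - Finsupp.single v 1 + Finsupp.single v 1 = s :=
      Finsupp.sub_add_single_one_cancel hv
    rw [h2] at h1
    rcases mul_eq_zero.1 h1 with h3 | h3
    · exact h3
    · exfalso
      have : (((s - Finsupp.single v 1 : τ →₀ ℕ) v + 1 : ℕ) : k) ≠ 0 :=
        Nat.cast_ne_zero.2 (by omega)
      exact this (by push_cast; exact h3)

/-- Differentiation lowers the degree. -/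
theorem totalDegree_pderiv_lt {τ k : Type*} [Field k] (p : MvPolynomial τ k) (v : τ)
    (h : pderiv v p ≠ 0) : (pderiv v p).totalDegree < p.totalDegree := by
  classical
  obtain ⟨s, hs, hd⟩ := Finset.exists_mem_eq_sup _ (support_nonempty.2 h)
    (fun s : τ →₀ ℕ => s.sum fun _ e => e)
  have hd : (pderiv v p).totalDegree = s.sum fun _ e => e := hd
  have h1 : s + Finsupp.single v 1 ∈ p.support := by
    rw [mem_support_iff] at hs ⊢
    rw [coeff_pderiv] at hs
    exact left_ne_zero_of_mul hs
  have h2 := le_totalDegree h1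
  rw [Finsupp.sum_add_index' (fun _ => rfl) (fun _ _ _ => rfl), Finsupp.sum_single_index rfl,
    ← hd] at h2
  omega

/-- In characteristic zero, a proper ideal stable under all partial derivatives is zero. -/
theorem eq_zero_of_mem_of_pderiv_stable {τ k : Type*} [Field k] [CharZero k]
    (I : Ideal (MvPolynomial τ k)) (hI : I ≠ ⊤) (hd : ∀ p ∈ I, ∀ v, pderiv v p ∈ I)
    (p : MvPolynomial τ k) (hp : p ∈ I) : p = 0 := by
  induction hn : p.totalDegree using Nat.strong_induction_on generalizing p with
  | _ n ih =>
    have h0 : ∀ v, pderiv v p = 0 := by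
      intro v
      by_contra hv
      exact hv (ih _ (hn ▸ totalDegree_pderiv_lt p v hv) _ (hd p hp v) rfl)
    rw [eq_C_of_forall_pderiv_eq_zero p h0] at hp ⊢
    by_contra hc
    have hc' : p.coeff 0 ≠ 0 := fun h => hc (by rw [h, C_0])
    exact hI (Ideal.eq_top_of_isUnit_mem _ hp ((isUnit_iff_ne_zero.2 hc').map C))

end MvPolynomial

/-- Every extension of fields of characteristic zero is formally smooth. -/
theorem Algebra.FormallySmooth.of_charZero (F K : Type*) [Field F] [Field K] [CharZero F]
    [Algebra F K] : Algebra.FormallySmooth F K := by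
  obtain ⟨s, hs⟩ := exists_isTranscendenceBasis F K
  have h1 := hs.isAlgebraic_field
  have : Algebra.IsSeparable (IntermediateField.adjoin F (Set.range ((↑) : s → K))) K := by
    infer_instance
  exact .of_algebraicIndependent_of_isSeparable hs.1

/-- A surjection `g : B → K` with nilpotent kernel onto a field of characteristic zero has a section,
with prescribed values on given algebraically independent elements: `K` is formally smooth over the
polynomial ring in these elements. -/
theorem AlgebraicIndependent.exists_algHom_lift {ι k K B : Type*} [Field k] [CharZero k]
    [Field K] [Algebra k K] [CommRing B] [Algebra k B] {x : ι → K}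
    (hx : AlgebraicIndependent k x) (g : B →ₐ[k] K) (hg : Function.Surjective g)
    (hnil : IsNilpotent (RingHom.ker g)) (b : ι → B) (hb : ∀ i, g (b i) = x i) :
    ∃ Φ : K →ₐ[k] B, (∀ z, g (Φ z) = z) ∧ ∀ i, Φ (x i) = b i := by
  let A := MvPolynomial ι k
  let e : A →ₐ[k] B := MvPolynomial.aeval b
  have hge : g.comp e = MvPolynomial.aeval x := by
    ext i
    simp [e, hb]
  let _ : Algebra A K := (MvPolynomial.aeval x : A →ₐ[k] K).toAlgebra
  let _ : Algebra A B := e.toAlgebra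
  have : IsScalarTower k A K := .of_algebraMap_eq' (MvPolynomial.aeval x).comp_algebraMap.symm
  have : IsScalarTower k A B := .of_algebraMap_eq' e.comp_algebraMap.symm
  have : FaithfulSMul A K := (faithfulSMul_iff_algebraMap_injective A K).2 hx
  let _ : Algebra (FractionRing A) K := FractionRing.liftAlgebra A K
  have : CharZero (FractionRing A) :=
    charZero_of_injective_algebraMap (algebraMap k (FractionRing A)).injective
  have : Algebra.FormallySmooth (FractionRing A) K := .of_charZero _ _
  have : Algebra.FormallySmooth A (FractionRing A) := .of_isLocalization (nonZeroDivisors A)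
  have : Algebra.FormallySmooth A K := .comp A (FractionRing A) K
  let π : B →ₐ[A] K := { g with commutes' := fun a => DFunLike.congr_fun hge a }
  let Φ : K →ₐ[A] B := Algebra.FormallySmooth.liftOfSurjective (AlgHom.id A K) π hg hnil
  refine ⟨Φ.restrictScalars k, fun z =>
    Algebra.FormallySmooth.liftOfSurjective_apply (AlgHom.id A K) π hg hnil z, fun i => ?_⟩
  have h1 : algebraMap A K (MvPolynomial.X i) = x i := MvPolynomial.aeval_X _ _
  have h2 : algebraMap A B (MvPolynomial.X i) = b i := MvPolynomial.aeval_X _ _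
  rw [AlgHom.restrictScalars_apply, ← h1, Φ.commutes, h2]

/-- Over a field of characteristic zero, a derivation may be prescribed freely on algebraically
independent elements of an extension field. The derivation `D` is encoded by the homomorphism
`z ↦ z + D z ε` to the dual numbers. -/
theorem AlgebraicIndependent.exists_algHom_dualNumber {ι k K : Type*} [Field k] [CharZero k]
    [Field K] [Algebra k K] {x : ι → K} (hx : AlgebraicIndependent k x) (d : ι → K) :
    ∃ Φ : K →ₐ[k] K[ε], (∀ z, (Φ z).fst = z) ∧ ∀ i, (Φ (x i)).snd = d i := by
  have hnil : IsNilpotent (RingHom.ker (TrivSqZeroExt.fstHom k K K)) := by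
    have h2 : RingHom.ker (TrivSqZeroExt.fstHom k K K) ^ 2 = ⊥ := by
      rw [pow_two, ← le_bot_iff, Ideal.mul_le]
      intro r hr s hs
      replace hr : r.fst = 0 := hr
      replace hs : s.fst = 0 := hs
      rw [Ideal.mem_bot]
      ext <;> simp [hr, hs]
    exact ⟨2, h2⟩
  obtain ⟨Φ, h1, h2⟩ := hx.exists_algHom_lift (TrivSqZeroExt.fstHom k K K)
    TrivSqZeroExt.fst_surjective hnil
    (fun i => TrivSqZeroExt.inl (x i) + TrivSqZeroExt.inr (d i)) (fun i => by simp)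
  exact ⟨Φ, h1, fun i => by rw [h2]; simp⟩

/-! ### Maximal minors -/

namespace Matrix

/-- A matrix over a field has full row rank iff some maximal minor does not vanish. -/
theorem rank_eq_card_iff_exists_det_ne_zero {T C F : Type*} [Field F] [Fintype T] [Fintype C]
    [DecidableEq T] (A : Matrix T C F) :
    A.rank = Fintype.card T ↔ ∃ f : T → C, (A.submatrix id f).det ≠ 0 := by
  constructor
  · intro h
    have hs : Submodule.span F (Set.range A.col) = ⊤ := by
      apply Submodule.eq_top_of_finrank_eq
      rw [← rank_eq_finrank_span_cols, h, Module.finrank_fintype_fun_eq_card]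
    obtain ⟨κ, a, ha, hspan, hli⟩ := exists_linearIndependent' F A.col
    rw [hs] at hspan
    let b := Module.Basis.mk hli hspan.ge
    let e : T ≃ κ := (Pi.basisFun F T).indexEquiv b
    refine ⟨a ∘ e, ?_⟩
    have h1 : LinearIndependent F (A.submatrix id (a ∘ e)).col :=
      hli.comp e e.injective
    rw [linearIndependent_cols_iff_isUnit, isUnit_iff_isUnit_det] at h1
    exact h1.ne_zero
  · rintro ⟨f, hf⟩
    apply le_antisymm (rank_le_card_height A)
    rw [← rank_of_det_ne_zero hf]
    exact rank_submatrix_le A id f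

end Matrix

/-! ### Triangular systems -/

namespace MvPolynomial

section Triangular

variable {σ k : Type*} [Field k]

theorem aeval_congr_of_vars {A : Type*} [CommRing A] [Algebra k A] {a b : σ → A}
    {p : MvPolynomial σ k} (h : ∀ v ∈ p.vars, a v = b v) : aeval a p = aeval b p :=
  eval₂Hom_congr' rfl (fun v hv _ => h v hv) rfl

theorem aeval_algebraMap_X {A : Type*} [CommRing A] [Algebra k A] [Algebra (MvPolynomial σ k) A]
    [IsScalarTower k (MvPolynomial σ k) A] (p : MvPolynomial σ k) :
    aeval (fun v => algebraMap (MvPolynomial σ k) A (X v)) p = algebraMap _ A p := by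
  have : (aeval fun v => algebraMap (MvPolynomial σ k) A (X v)) =
      IsScalarTower.toAlgHom k (MvPolynomial σ k) A := by
    ext v
    simp
  exact DFunLike.congr_fun this p

/-- A set `S` of polynomials is triangular, with common initial `Q`, if each `P ∈ S` has the form
`Q * X (lead P) - B`, where distinct `P` have distinct leaders, the indeterminates of `B` have a
smaller rank `ρ` than `lead P`, and no leader occurs in `Q`. -/
structure IsTriangular (Q : MvPolynomial σ k) (S : Set (MvPolynomial σ k)) (ρ : σ → ℕ)
    (lead : S → σ) : Prop where
  ne_zero : Q ≠ 0
  injective : Function.Injective lead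
  notMem_vars : ∀ P, lead P ∉ Q.vars
  rank_lt : ∀ P : S, ∀ w ∈ (Q * X (lead P) - (P : MvPolynomial σ k)).vars, ρ w < ρ (lead P)

namespace IsTriangular

variable {Q : MvPolynomial σ k} {S : Set (MvPolynomial σ k)} {ρ : σ → ℕ} {lead : S → σ}

/-- A triangular system is solved for its leaders, in the order of their ranks, by rational
functions in the other indeterminates. -/
theorem exists_solution (h : IsTriangular Q S ρ lead) :
    ∃ a : σ → FractionRing (MvPolynomial σ k),
      (∀ v ∉ Set.range lead, a v = algebraMap (MvPolynomial σ k) _ (X v)) ∧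
      ∀ P : S, aeval a (P : MvPolynomial σ k) = 0 := by
  classical
  let K := FractionRing (MvPolynomial σ k)
  let q : K := algebraMap (MvPolynomial σ k) K Q
  have hq : q ≠ 0 := by
    rw [Ne, map_eq_zero_iff _ (IsFractionRing.injective (MvPolynomial σ k) K)]
    exact h.ne_zero
  let T : S → MvPolynomial σ k := fun P => Q * X (lead P) - (P : MvPolynomial σ k)
  let step : (σ → K) → σ → K := fun b v =>
    if hv : ∃ P, lead P = v then aeval b (T hv.choose) / q else algebraMap (MvPolynomial σ k) K (X v)
  have hstep : ∀ b P, step b (lead P) = aeval b (T P) / q := by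
    intro b P
    have hv : ∃ P', lead P' = lead P := ⟨P, rfl⟩
    simp only [step, dif_pos hv, h.injective hv.choose_spec]
  have hstep' : ∀ b, ∀ v ∉ Set.range lead, step b v = algebraMap (MvPolynomial σ k) K (X v) :=
    fun b v hv => dif_neg hv
  -- The value at an indeterminate of rank `r` is stationary after `r + 1` steps.
  let s : ℕ → σ → K := fun r => step^[r] 0
  have hs : ∀ r, s (r + 1) = step (s r) := fun r => Function.iterate_succ_apply' step r 0
  have hstat : ∀ r v, ρ v < r → s (r + 1) v = s r v := by
    intro r
    induction r with
    | zero => exact fun v hv => absurd hv (Nat.not_lt_zero _)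
    | succ r ih =>
      intro v hv
      rw [hs (r + 1)]
      by_cases hl : v ∈ Set.range lead
      · obtain ⟨P, rfl⟩ := hl
        rw [hs r, hstep, hstep]
        congr 1
        refine aeval_congr_of_vars fun w hw => ?_
        rw [← hs r]
        exact ih w (lt_of_lt_of_le (h.rank_lt P w hw) (Nat.lt_succ_iff.1 hv))
      · rw [hs r, hstep' _ v hl, hstep' _ v hl]
  have hlim : ∀ v r, ρ v < r → s r v = s (ρ v + 1) v := by
    intro v r hr
    induction r, Nat.succ_le_of_lt hr using Nat.le_induction with
    | base => rfl
    | succ r hr' ih => rw [hstat r v hr', ih hr']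
  refine ⟨fun v => s (ρ v + 1) v, fun v hv => ?_, fun P => ?_⟩
  · exact (congrFun (hs _) v).trans (hstep' _ v hv)
  · have hQ : aeval (fun v => s (ρ v + 1) v) Q = q := by
      rw [aeval_congr_of_vars (b := fun v => algebraMap (MvPolynomial σ k) K (X v))]
      · exact aeval_algebraMap_X Q
      · intro v hv
        have hv' : v ∉ Set.range lead := by
          rintro ⟨P, rfl⟩
          exact h.notMem_vars P hv
        rw [hs, hstep' _ v hv']
    have hP : (P : MvPolynomial σ k) = Q * X (lead P) - T P := by simp [T]
    rw [hP, map_sub, map_mul, aeval_X, hQ, hs, hstep, mul_div_cancel₀ _ hq, sub_eq_zero]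
    exact aeval_congr_of_vars fun w hw => hlim w _ (h.rank_lt P w hw)

/-- Modulo a triangular system, every polynomial becomes, after multiplication by a power of the
initial, a polynomial without leaders. -/
theorem exists_reduction (h : IsTriangular Q S ρ lead) (r : MvPolynomial σ k) :
    ∃ (N : ℕ), ∃ r₀ ∈ supported k (Set.range lead)ᶜ, Q ^ N * r - r₀ ∈ Ideal.span S := by
  have hQ : Q ∈ supported k (Set.range lead)ᶜ := by
    rw [mem_supported]
    rintro v hv ⟨P, rfl⟩
    exact h.notMem_vars P hv
  let D : Subalgebra k (MvPolynomial σ k) :=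
    { carrier := {r | ∃ (N : ℕ), ∃ r₀ ∈ supported k (Set.range lead)ᶜ,
        Q ^ N * r - r₀ ∈ Ideal.span S}
      algebraMap_mem' := fun c => ⟨0, algebraMap k _ c, Subalgebra.algebraMap_mem _ c, by simp⟩
      add_mem' := by
        rintro a b ⟨N, a₀, ha₀, ha⟩ ⟨N', b₀, hb₀, hb⟩
        refine ⟨N + N', Q ^ N' * a₀ + Q ^ N * b₀,
          add_mem (mul_mem (pow_mem hQ _) ha₀) (mul_mem (pow_mem hQ _) hb₀), ?_⟩
        have := add_mem (Ideal.mul_mem_left _ (Q ^ N') ha) (Ideal.mul_mem_left _ (Q ^ N) hb)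
        convert! this using 1
        ring
      mul_mem' := by
        rintro a b ⟨N, a₀, ha₀, ha⟩ ⟨N', b₀, hb₀, hb⟩
        refine ⟨N + N', a₀ * b₀, mul_mem ha₀ hb₀, ?_⟩
        have := add_mem (Ideal.mul_mem_left _ (Q ^ N' * b) ha) (Ideal.mul_mem_left _ a₀ hb)
        convert! this using 1
        ring }
  have hX : ∀ d v, ρ v = d → X v ∈ D := by
    intro d
    induction d using Nat.strong_induction_on with
    | _ d ih =>
      rintro v rfl
      by_cases hv : v ∈ Set.range lead
      · obtain ⟨P, rfl⟩ := hv
        have hle : supported k {w | ρ w < ρ (lead P)} ≤ D := by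
          rw [supported, Algebra.adjoin_le_iff]
          rintro _ ⟨w, hw, rfl⟩
          exact ih _ hw w rfl
        obtain ⟨N, r₀, hr₀, hr⟩ := hle (mem_supported.2 (h.rank_lt P))
        refine ⟨N + 1, r₀, hr₀, ?_⟩
        have := add_mem hr (Ideal.mul_mem_left _ (Q ^ N) (Ideal.subset_span P.2))
        convert! this using 1
        ring
      · exact ⟨0, X v, X_mem_supported.2 hv, by simp⟩
  have hD : D = ⊤ := by
    rw [eq_top_iff, ← adjoin_range_X, Algebra.adjoin_le_iff]
    rintro _ ⟨v, rfl⟩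
    exact hX _ v rfl
  exact (hD ▸ Algebra.mem_top : r ∈ D)

/-- The saturation of the ideal of a triangular system by its initial is the kernel of a
homomorphism to a field: the system has a generic point. -/
theorem exists_genericPoint (h : IsTriangular Q S ρ lead) :
    ∃ φ : MvPolynomial σ k →ₐ[k] FractionRing (MvPolynomial σ k),
      φ Q ≠ 0 ∧ ∀ r, φ r = 0 ↔ ∃ N : ℕ, Q ^ N * r ∈ Ideal.span S := by
  obtain ⟨a, ha, hS⟩ := h.exists_solution
  have hfree : ∀ r ∈ supported k (Set.range lead)ᶜ,
      aeval a r = algebraMap (MvPolynomial σ k) (FractionRing (MvPolynomial σ k)) r := by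
    intro r hr
    rw [aeval_congr_of_vars fun v hv => ha v (mem_supported.1 hr hv)]
    exact aeval_algebraMap_X r
  have hinj := IsFractionRing.injective (MvPolynomial σ k) (FractionRing (MvPolynomial σ k))
  have hQ : aeval a Q ≠ 0 := by
    rw [hfree Q, Ne, map_eq_zero_iff _ hinj]
    · exact h.ne_zero
    · rw [mem_supported]
      rintro v hv ⟨P, rfl⟩
      exact h.notMem_vars P hv
  have hI : Ideal.span S ≤ RingHom.ker (aeval a : MvPolynomial σ k →ₐ[k] _) :=
    Ideal.span_le.2 fun P hP => hS ⟨P, hP⟩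
  refine ⟨aeval a, hQ, fun r => ⟨fun hr => ?_, ?_⟩⟩
  · obtain ⟨N, r₀, hr₀, hN⟩ := h.exists_reduction r
    have h0 : aeval a (Q ^ N * r - r₀) = 0 := hI hN
    rw [map_sub, map_mul, hr, mul_zero, zero_sub, neg_eq_zero, hfree _ hr₀,
      map_eq_zero_iff _ hinj] at h0
    rw [h0, sub_zero] at hN
    exact ⟨N, hN⟩
  · rintro ⟨N, hN⟩
    have h0 : aeval a (Q ^ N * r) = 0 := hI hN
    rw [map_mul, map_pow] at h0
    exact (mul_eq_zero.1 h0).resolve_left (pow_ne_zero _ hQ)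

theorem pderiv_lead_self (h : IsTriangular Q S ρ lead) (P : S) :
    pderiv (lead P) (P : MvPolynomial σ k) = Q := by
  have h1 : pderiv (lead P) (Q * X (lead P) - (P : MvPolynomial σ k)) = 0 :=
    pderiv_eq_zero_of_notMem_vars fun hw => lt_irrefl _ (h.rank_lt P _ hw)
  rw [map_sub, pderiv_mul, pderiv_X_self, pderiv_eq_zero_of_notMem_vars (h.notMem_vars P)] at h1
  simpa using (sub_eq_zero.1 h1).symm

theorem pderiv_lead_of_ne (h : IsTriangular Q S ρ lead) {P P' : S} (hne : P' ≠ P)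
    (hle : ρ (lead P') ≤ ρ (lead P)) : pderiv (lead P) (P' : MvPolynomial σ k) = 0 := by
  have h1 : pderiv (lead P) (Q * X (lead P') - (P' : MvPolynomial σ k)) = 0 :=
    pderiv_eq_zero_of_notMem_vars fun hw => not_lt_of_ge hle (h.rank_lt P' _ hw)
  rw [map_sub, pderiv_mul, pderiv_X_of_ne (h.injective.ne hne),
    pderiv_eq_zero_of_notMem_vars (h.notMem_vars P)] at h1
  simpa using h1

/-- The full Jacobian matrix of a triangular system has independent rows wherever the initial does
not vanish. -/
theorem eq_zero_of_sum_pderiv_eq_zero (h : IsTriangular Q S ρ lead) {T : Type*} [Fintype T]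
    {s : T → S} (hs : Function.Injective s) {K : Type*} [Field K] [Algebra k K]
    (φ : MvPolynomial σ k →ₐ[k] K) (hφ : φ Q ≠ 0) (c : T → K)
    (hc : ∀ t, ∑ t', c t' * φ (pderiv (lead (s t)) (s t' : MvPolynomial σ k)) = 0) : c = 0 := by
  classical
  by_contra hne
  obtain ⟨t₁, ht₁⟩ := Function.ne_iff.1 hne
  -- Among the rows that occur, one of maximal rank has the only nonzero entry of its leader column.
  obtain ⟨t, ht, hmax⟩ := Finset.exists_max_image (Finset.univ.filter fun t => c t ≠ 0)
    (fun t => ρ (lead (s t))) ⟨t₁, by simpa using ht₁⟩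
  rw [Finset.mem_filter] at ht
  have h1 := hc t
  rw [Finset.sum_eq_single t, h.pderiv_lead_self] at h1
  · exact (mul_ne_zero ht.2 hφ) h1
  · intro t' _ ht'
    by_cases h0 : c t' = 0
    · rw [h0, zero_mul]
    · rw [h.pderiv_lead_of_ne (hs.ne ht') (hmax t' (by simpa using h0)), map_zero, mul_zero]
  · simp

end IsTriangular

end Triangular

end MvPolynomial

/-! ### The Jacobian criterion at a generic point -/

namespace MvPolynomial.IsTriangular

variable {σ k α β : Type*} [Field k] {Q : MvPolynomial σ k} {S : Set (MvPolynomial σ k)}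
  {ρ : σ → ℕ} {lead : S → σ}

/-- If a homomorphism to the dual numbers lifts a generic point of a triangular system and kills the
system, then it kills all polynomials vanishing at the generic point. -/
theorem algHom_dualNumber_eq_zero {K : Type*} [Field K] [Algebra k K]
    {φ : MvPolynomial σ k →ₐ[k] K} (hQ : φ Q ≠ 0)
    (hφ : ∀ r, φ r = 0 → ∃ N : ℕ, Q ^ N * r ∈ Ideal.span S) (Ψ : MvPolynomial σ k →ₐ[k] K[ε])
    (hfst : ∀ r, (Ψ r).fst = φ r) (hS : ∀ P ∈ S, Ψ P = 0) {r : MvPolynomial σ k} (hr : φ r = 0) :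
    Ψ r = 0 := by
  obtain ⟨N, hN⟩ := hφ r hr
  have hle : Ideal.span S ≤ RingHom.ker Ψ := Ideal.span_le.2 hS
  have h0 : Ψ (Q ^ N * r) = 0 := hle hN
  rw [map_mul, map_pow] at h0
  have hu : IsUnit (Ψ Q ^ N) := by
    refine IsUnit.pow N ?_
    rw [TrivSqZeroExt.isUnit_iff_isUnit_fst, hfst]
    exact isUnit_iff_ne_zero.2 hQ
  exact hu.mul_right_eq_zero.1 h0

/-- Jacobian criterion: at a generic point `φ` of a triangular system in the coordinates `α ⊕ β`,
the `β`-coordinates are algebraically independent iff the Jacobian matrix with respect to the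
`α`-coordinates has full row rank. -/
theorem algebraicIndependent_iff_rank_jacobian [CharZero k] (h : IsTriangular Q S ρ lead)
    [Fintype α] [Fintype β] {e : α ⊕ β → σ} (he : Function.Injective e)
    (hS : S ⊆ Set.range (rename e : MvPolynomial (α ⊕ β) k →ₐ[k] MvPolynomial σ k))
    {T : Set (MvPolynomial (α ⊕ β) k)} (hT : ∀ p, p ∈ T ↔ rename e p ∈ S) [Fintype T]
    {K : Type*} [Field K] [Algebra k K] (φ : MvPolynomial σ k →ₐ[k] K) (hQ : φ Q ≠ 0)
    (hφ : ∀ r, φ r = 0 ↔ ∃ N : ℕ, Q ^ N * r ∈ Ideal.span S) :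
    AlgebraicIndependent k (fun w : β => φ (X (e (Sum.inr w)))) ↔
      (Matrix.of fun (P : T) (v : α) => φ (rename e (pderiv (Sum.inl v) P.1))).rank =
        Fintype.card T := by
  classical
  let ι := rename (R := k) e
  let A : Matrix T α K := Matrix.of fun P v => φ (ι (pderiv (Sum.inl v) P.1))
  have hφS : ∀ P ∈ S, φ P = 0 := fun P hP =>
    (hφ P).2 ⟨0, by simpa using Ideal.subset_span hP⟩
  constructor
  · intro hx
    have hli : LinearIndependent K A.row := by
      rw [Fintype.linearIndependent_iff]
      intro c hc
      have hα : ∀ v : α, ∑ P : T, c P * φ (ι (pderiv (Sum.inl v) P.1)) = 0 := by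
        intro v
        have := congrFun hc v
        simpa [A, Matrix.row] using this
      -- Applying a derivation of `K` that extends `∂ / ∂ w` to the equations of the system shows
      -- that the relation `c` extends to the columns in `β`.
      have hβ : ∀ w : β, ∑ P : T, c P * φ (ι (pderiv (Sum.inr w) P.1)) = 0 := by
        intro w
        obtain ⟨Φ, h1, h2⟩ := hx.exists_algHom_dualNumber (Pi.single w 1)
        have hP : ∀ P : T, (∑ v, φ (ι (pderiv (Sum.inl v) P.1)) * (Φ (φ (ι (X (Sum.inl v))))).snd)
            + φ (ι (pderiv (Sum.inr w) P.1)) = 0 := by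
          intro P
          have h3 := snd_algHom_dualNumber (φ.comp ι) (Φ.comp (φ.comp ι)) (fun p => h1 _) P.1
          have h4 : (Φ.comp (φ.comp ι)) P.1 = 0 := by
            simp [ι, hφS _ ((hT _).1 P.2)]
          rw [h4, Fintype.sum_sum_type] at h3
          have h5 : ∀ w', (Φ.comp (φ.comp ι) (X (Sum.inr w'))).snd =
              Pi.single (M := fun _ => K) w 1 w' := by
            intro w'
            rw [← h2 w']
            simp [ι]
          simp only [h5, Pi.single_apply, mul_ite, mul_one, mul_zero, Finset.sum_ite_eq',
            Finset.mem_univ, if_true] at h3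
          exact h3.symm
        have h6 : ∑ P : T, c P * ((∑ v, φ (ι (pderiv (Sum.inl v) P.1)) *
            (Φ (φ (ι (X (Sum.inl v))))).snd) + φ (ι (pderiv (Sum.inr w) P.1))) = 0 :=
          Finset.sum_eq_zero fun P _ => by rw [hP P, mul_zero]
        simp only [mul_add, Finset.sum_add_distrib, Finset.mul_sum] at h6
        rw [Finset.sum_comm] at h6
        simp only [← mul_assoc, ← Finset.sum_mul, hα, zero_mul, Finset.sum_const_zero,
          zero_add] at h6
        exact h6
      refine congrFun (h.eq_zero_of_sum_pderiv_eq_zero (s := fun P : T => (⟨ι P.1, (hT _).1 P.2⟩ : S))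
        (fun P P' hPP' => Subtype.ext (rename_injective e he (congrArg Subtype.val hPP')))
        φ hQ c fun P => ?_)
      obtain ⟨v, hv⟩ : lead ⟨ι P.1, (hT _).1 P.2⟩ ∈ Set.range e := by
        have hmem : lead ⟨ι P.1, (hT _).1 P.2⟩ ∈ (ι P.1).vars := by
          by_contra hn
          exact h.ne_zero ((h.pderiv_lead_self ⟨ι P.1, (hT _).1 P.2⟩).symm.trans
            (pderiv_eq_zero_of_notMem_vars hn))
        obtain ⟨v, -, hv⟩ := mem_vars_rename e P.1 hmem
        exact ⟨v, hv⟩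
      have hd : ∀ P' : T, pderiv (e v) (ι P'.1) = ι (pderiv v P'.1) :=
        fun P' => pderiv_rename he v P'.1
      simp only [← hv, hd]
      rcases v with v | w
      · exact hα v
      · exact hβ w
    exact hli.rank_matrix
  · intro hrank
    have hsurj : Function.Surjective A.mulVecLin := by
      rw [← LinearMap.range_eq_top]
      apply Submodule.eq_top_of_finrank_eq
      rw [Module.finrank_fintype_fun_eq_card, ← hrank]
      rfl
    let j : MvPolynomial β k →ₐ[k] MvPolynomial (α ⊕ β) k := rename Sum.inr
    have hj : (aeval fun w : β => φ (X (e (Sum.inr w)))) = φ.comp (ι.comp j) := by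
      ext w
      simp [ι, j]
    rw [AlgebraicIndependent, injective_iff_map_eq_zero, hj]
    refine eq_zero_of_mem_of_pderiv_stable (RingHom.ker (φ.comp (ι.comp j)))
      (RingHom.ker_ne_top _) ?_
    intro p hp w
    -- A tangent vector of the system at the generic point with `β`-component `∂ / ∂ w`.
    obtain ⟨d, hd⟩ := hsurj fun P : T => - φ (ι (pderiv (Sum.inr w) P.1))
    let δ : σ → K := Function.extend e (Sum.elim d (Pi.single w 1)) 0
    let Ψ : MvPolynomial σ k →ₐ[k] K[ε] :=
      aeval fun s => TrivSqZeroExt.inl (φ (X s)) + TrivSqZeroExt.inr (δ s)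
    have hfst : ∀ r, (Ψ r).fst = φ r := by
      have : (TrivSqZeroExt.fstHom k K K).comp Ψ = φ := by
        ext s
        simp [Ψ]
      exact fun r => DFunLike.congr_fun this r
    have hsnd : ∀ p, (Ψ (ι p)).snd =
        ∑ v, φ (ι (pderiv (Sum.inl v) p)) * d v + φ (ι (pderiv (Sum.inr w) p)) := by
      intro p
      have h1 := snd_algHom_dualNumber (φ.comp ι) (Ψ.comp ι) (fun p => hfst _) p
      have h2 : ∀ v, (Ψ (ι (X v))).snd = Sum.elim d (Pi.single w 1) v := by
        intro v
        simp [Ψ, ι, δ, he.extend_apply]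
      simpa only [h2, Fintype.sum_sum_type, Sum.elim_inl, Sum.elim_inr, Pi.single_apply, mul_ite,
        mul_one, mul_zero, Finset.sum_ite_eq', Finset.mem_univ, if_true, AlgHom.comp_apply] using h1
    have hΨS : ∀ P ∈ S, Ψ P = 0 := by
      intro P hP
      obtain ⟨P, rfl⟩ := hS hP
      ext
      · rw [hfst, hφS _ hP]
        rfl
      · have h1 := congrFun hd ⟨P, (hT _).2 hP⟩
        have h2 : ∑ v, φ (ι (pderiv (Sum.inl v) P)) * d v = - φ (ι (pderiv (Sum.inr w) P)) := h1
        have h3 := hsnd P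
        rw [h2, neg_add_cancel] at h3
        exact h3
    have h0 := algHom_dualNumber_eq_zero hQ (fun r => (hφ r).1) Ψ hfst hΨS
      (r := ι (j p)) hp
    have h1 := hsnd (j p)
    have h2 : ∀ v : α, pderiv (Sum.inl v) (j p) = 0 := by
      intro v
      refine pderiv_eq_zero_of_notMem_vars fun hv => ?_
      obtain ⟨_, -, hw⟩ := mem_vars_rename _ _ hv
      exact Sum.inr_ne_inl hw
    have h3 : pderiv (Sum.inr w) (j p) = j (pderiv w p) := pderiv_rename Sum.inr_injective w p
    rw [h0, h3] at h1
    simp only [h2, map_zero, zero_mul, Finset.sum_const_zero, zero_add] at h1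
    exact h1.symm

end MvPolynomial.IsTriangular

/-! ### The Zariski topology -/

section Zariski

open MvPolynomial

variable {σ : Type}

theorem isClosed_zariski_iff {A : Set (σ → ℂ)} :
    @IsClosed _ (zariski σ) A ↔ ∃ I : Ideal (MvPolynomial σ ℂ), A = zeroLocus ℂ I := by
  rw [← @isOpen_compl_iff _ _ (zariski σ)]
  change Aᶜᶜ ∈ _ ↔ _
  rw [compl_compl]
  rfl

/-- The Zariski closure of a set is the zero set of all polynomials vanishing on it. -/
theorem closure_zariski (W : Set (σ → ℂ)) :
    @closure _ (zariski σ) W = zeroLocus ℂ (vanishingIdeal ℂ W) := by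
  let _ := zariski σ
  apply Set.Subset.antisymm
  · exact closure_minimal (zeroLocus_vanishingIdeal_le W) (isClosed_zariski_iff.2 ⟨_, rfl⟩)
  · obtain ⟨I, hI⟩ := isClosed_zariski_iff.1 (isClosed_closure (s := W))
    rw [hI]
    refine zeroLocus_anti_mono (le_zeroLocus_iff_le_vanishingIdeal.1 ?_)
    rw [← hI]
    exact subset_closure

theorem dense_zariski_iff (W : Set (σ → ℂ)) :
    @Dense _ (zariski σ) W ↔ vanishingIdeal ℂ W = ⊥ := by
  rw [@dense_iff_closure_eq _ (zariski σ), closure_zariski]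
  constructor
  · intro h
    rw [eq_bot_iff]
    intro p hp
    refine MvPolynomial.funext fun x => ?_
    have hx : x ∈ zeroLocus ℂ (vanishingIdeal ℂ W) := h ▸ Set.mem_univ x
    simpa using hx p hp
  · intro h
    rw [h, zeroLocus_bot]
    rfl

/-- Irreducibility of the zero set of a prime ideal: the complement of a proper hypersurface section
is dense. -/
theorem zeroLocus_subset_closure_of_notMem [Finite σ] (I : Ideal (MvPolynomial σ ℂ)) [I.IsPrime]
    {g : MvPolynomial σ ℂ} (hg : g ∉ I) :
    zeroLocus ℂ I ⊆ @closure _ (zariski σ) ({p | eval p g ≠ 0} ∩ zeroLocus ℂ I) := by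
  rw [closure_zariski]
  refine zeroLocus_anti_mono fun f hf => ?_
  have h1 : f * g ∈ vanishingIdeal ℂ (zeroLocus ℂ I) := by
    intro x hx
    by_cases hgx : eval x g = 0
    · simp [hgx]
    · rw [map_mul, hf x ⟨hgx, hx⟩, zero_mul]
  rw [IsPrime.vanishingIdeal_zeroLocus] at h1
  exact (Ideal.IsPrime.mem_or_mem ‹_› h1).resolve_right hg

theorem isOpen_zariski_eval_ne_zero (g : MvPolynomial σ ℂ) :
    @IsOpen _ (zariski σ) {p | eval p g ≠ 0} := by
  rw [← @isClosed_compl_iff _ (zariski σ), isClosed_zariski_iff]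
  refine ⟨Ideal.span {g}, ?_⟩
  rw [zeroLocus_span]
  ext p
  simp

end Zariski

/-! ### The system of a differential model -/

open MvPolynomial

/-- A ranking of the indeterminates for which `y k ^ (j)` is the leader of `(Q y k - G k) ^ (j)` and
`x i ^ (j + 1)` is the leader of `(Q (x i)' - F i) ^ (j)`. Parameters and inputs are never leaders
and get rank `0`. -/
def DVar.rank {n m l : ℕ} : DVar n m l → ℕ
  | .mu _ => 0
  | .x _ j => j + 1
  | .y _ j => j + 2
  | .u _ => 0

theorem dder_mem_supported_rank {n m l : ℕ} (r : ℕ) (p : DPoly n m l)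
    (hp : p ∈ supported ℂ {v : DVar n m l | v.rank < r}) :
    dder n m l p ∈ supported ℂ {v : DVar n m l | v.rank < r + 1} := by
  have hle : supported ℂ {v : DVar n m l | v.rank < r} ≤
      supported ℂ {v : DVar n m l | v.rank < r + 1} :=
    supported_mono fun v hv => Nat.lt_succ_of_lt hv
  induction hp using Algebra.adjoin_induction with
  | mem q hq =>
    obtain ⟨v, hv, rfl⟩ := hq
    rw [dder, mkDerivation_X]
    rcases v with a | ⟨i, j⟩ | ⟨k, j⟩ | j
    · exact Subalgebra.zero_mem _
    · exact X_mem_supported.2 (Nat.succ_lt_succ hv)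
    · exact X_mem_supported.2 (Nat.succ_lt_succ hv)
    · exact X_mem_supported.2 (Nat.succ_pos r)
  | algebraMap c => rw [Derivation.map_algebraMap]; exact Subalgebra.zero_mem _
  | add p q _ _ h1 h2 => rw [map_add]; exact Subalgebra.add_mem _ h1 h2
  | mul p q hp hq h1 h2 =>
    rw [Derivation.leibniz]
    exact Subalgebra.add_mem _ (Subalgebra.mul_mem _ (hle hp) h2)
      (Subalgebra.mul_mem _ (hle hq) h1)

/-- The derivatives of `q w - g` are `q w ^ (j) - B` with `B` of smaller rank than `w ^ (j)`. -/
theorem mul_X_sub_iterate_dder_mem_supported {n m l : ℕ} {q g : DPoly n m l}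
    (hq : q ∈ supported ℂ {v : DVar n m l | v.rank < 2})
    (hg : g ∈ supported ℂ {v : DVar n m l | v.rank < 2}) (w : ℕ → DVar n m l)
    (hw : ∀ j, dder n m l (X (w j)) = X (w (j + 1))) (hrank : ∀ j, (w j).rank = j + 2) (j : ℕ) :
    q * X (w j) - (dder n m l)^[j] (q * X (w 0) - g) ∈
      supported ℂ {v : DVar n m l | v.rank < j + 2} := by
  induction j with
  | zero => simpa using hg
  | succ j ih =>
    rw [Function.iterate_succ_apply']
    have h1 := dder_mem_supported_rank _ _ ih
    rw [map_sub, Derivation.leibniz, hw, smul_eq_mul, smul_eq_mul] at h1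
    have h2 : X (w j) * dder n m l q ∈ supported ℂ {v : DVar n m l | v.rank < j + 1 + 2} := by
      refine Subalgebra.mul_mem _ (X_mem_supported.2 ?_)
        (supported_mono ?_ (dder_mem_supported_rank _ _ hq))
      · rw [Set.mem_ofPred_eq, hrank]
        omega
      · intro v hv
        rw [Set.mem_ofPred_eq] at hv ⊢
        omega
    have h3 := Subalgebra.sub_mem _ h1 h2
    convert! h3 using 1
    ring

theorem BaseVar.toDVar_injective {n m l : ℕ} :
    Function.Injective (BaseVar.toDVar : BaseVar n l → DVar n m l) := by
  rintro (a | i | _) (b | j | _) h <;> simp_all [BaseVar.toDVar]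

theorem BaseVar.rank_toDVar_lt {n m l : ℕ} (v : BaseVar n l) :
    (v.toDVar : DVar n m l).rank < 2 := by
  rcases v with a | i | _ <;> simp [BaseVar.toDVar, DVar.rank]

theorem rank_lt_two_of_mem_vars_toDPoly {n m l : ℕ} {p : BasePoly n l} {v : DVar n m l}
    (hv : v ∈ (toDPoly p : DPoly n m l).vars) : v.rank < 2 := by
  obtain ⟨w, -, rfl⟩ := mem_vars_rename _ _ hv
  exact w.rank_toDVar_lt

namespace LcmForm

variable {n m l : ℕ} {M : DiffModel n m l} (L : LcmForm M)

theorem Q_ne_zero : L.Q ≠ 0 := by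
  have hd := (L.isLcm ((∏ i, (IsFractionRing.den (BasePoly n l) (M.f i) : BasePoly n l)) *
    ∏ k, (IsFractionRing.den (BasePoly n l) (M.g k) : BasePoly n l))).2
    ⟨fun i => Dvd.dvd.mul_right (Finset.dvd_prod_of_mem _ (Finset.mem_univ i)) _,
      fun k => Dvd.dvd.mul_left (Finset.dvd_prod_of_mem _ (Finset.mem_univ k)) _⟩
  exact ne_zero_of_dvd_ne_zero (mul_ne_zero
    (Finset.prod_ne_zero_iff.2 fun i _ => nonZeroDivisors.coe_ne_zero _)
    (Finset.prod_ne_zero_iff.2 fun k _ => nonZeroDivisors.coe_ne_zero _)) hd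

/-- The polynomials `(Q y k - G k) ^ (j)` and `(Q (x i)' - F i) ^ (j)`, indexed by `(k, j)` and
`(i, j)`. -/
noncomputable def poly : (Fin m × ℕ) ⊕ (Fin n × ℕ) → DPoly n m l
  | .inl a => L.outPoly a.1 a.2
  | .inr a => L.statePoly a.1 a.2

/-- The leaders of the polynomials `LcmForm.poly`. -/
def _root_.DVar.leader : (Fin m × ℕ) ⊕ (Fin n × ℕ) → DVar n m l
  | .inl a => .y a.1 a.2
  | .inr a => .x a.1 (a.2 + 1)

theorem _root_.DVar.leader_injective :
    Function.Injective (DVar.leader : _ → DVar n m l) := by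
  rintro (⟨k, j⟩ | ⟨i, j⟩) (⟨k', j'⟩ | ⟨i', j'⟩) h <;> simp_all [DVar.leader]

theorem _root_.DVar.two_le_rank_leader (t : (Fin m × ℕ) ⊕ (Fin n × ℕ)) :
    2 ≤ (DVar.leader t : DVar n m l).rank := by
  rcases t with ⟨k, j⟩ | ⟨i, j⟩ <;> simp [DVar.leader, DVar.rank]

theorem rank_lt_rank_leader (t : (Fin m × ℕ) ⊕ (Fin n × ℕ)) :
    ∀ v ∈ (toDPoly L.Q * X (DVar.leader t) - L.poly t).vars,
      v.rank < (DVar.leader t : DVar n m l).rank := by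
  have hsup : ∀ p : BasePoly n l,
      (toDPoly p : DPoly n m l) ∈ supported ℂ {v : DVar n m l | v.rank < 2} := fun p =>
    mem_supported.2 fun v hv => rank_lt_two_of_mem_vars_toDPoly hv
  rcases t with ⟨k, j⟩ | ⟨i, j⟩
  · exact mem_supported.1 (mul_X_sub_iterate_dder_mem_supported (hsup L.Q) (hsup (L.G k))
      (fun j => DVar.y k j) (fun j => by rw [dder, mkDerivation_X, DVar.next]) (fun j => rfl) j)
  · exact mem_supported.1 (mul_X_sub_iterate_dder_mem_supported (hsup L.Q) (hsup (L.F i))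
      (fun j => DVar.x i (j + 1)) (fun j => by rw [dder, mkDerivation_X, DVar.next])
      (fun j => rfl) j)

/-- `S_h` is a triangular system with initial `Q`. -/
theorem exists_isTriangular (h : Fin m → ℕ) :
    ∃ lead, IsTriangular (toDPoly L.Q) (L.S h) DVar.rank lead := by
  have hex : ∀ P : L.S h, ∃ t, L.poly t = P.1 := by
    rintro ⟨P, hP⟩
    rcases L.memS_cases h hP with ⟨k, j, -, rfl⟩ | ⟨i, j, -, rfl⟩
    · exact ⟨.inl (k, j), rfl⟩
    · exact ⟨.inr (i, j), rfl⟩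
  choose t ht using hex
  refine ⟨fun P => DVar.leader (t P), ?_, ?_, ?_, ?_⟩
  · rw [toDPoly, Ne, map_eq_zero_iff _ (rename_injective _ BaseVar.toDVar_injective)]
    exact L.Q_ne_zero
  · intro P P' hPP'
    refine Subtype.ext ?_
    rw [← ht P, ← ht P', DVar.leader_injective hPP']
  · intro P hP
    exact absurd (rank_lt_two_of_mem_vars_toDPoly hP) (not_lt_of_ge (DVar.two_le_rank_leader _))
  · intro P
    rw [← ht P]
    exact L.rank_lt_rank_leader (t P)

theorem ncard_S (h : Fin m → ℕ) : (L.S h).ncard = Nat.card (L.SR h) := by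
  have hinj : Function.Injective (L.incl h) := rename_injective _ (Coord.toDVar_injective L h)
  rw [← L.image_SR h, Set.ncard_image_of_injective _ hinj]
  rfl

theorem finite_SR (h : Fin m → ℕ) : (L.SR h).Finite :=
  (L.S_finite h).preimage (rename_injective _ (Coord.toDVar_injective L h)).injOn

variable {K : Type*} [Field K] [Algebra ℂ K]

/-- The projection is dominant iff the `(y_h, u_{In(h)})`-coordinates of a generic point `φ` of `Z_h`
are algebraically independent: the polynomials in these coordinates vanishing on `Z_h` are those in
`J_h`, by the Nullstellensatz. -/
theorem projDominant_iff (h : Fin m → ℕ) (φ : DPoly n m l →ₐ[ℂ] K)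
    (hJ : L.J h = RingHom.ker (φ.comp (L.incl h))) :
    L.ProjDominant h ↔
      AlgebraicIndependent ℂ fun w => φ (X (Coord.toDVar L h (Sum.inr w))) := by
  have hprime : (L.J h).IsPrime := hJ ▸ RingHom.ker_isPrime _
  rw [ProjDominant, dense_zariski_iff, AlgebraicIndependent, injective_iff_map_eq_zero,
    Submodule.eq_bot_iff]
  refine forall_congr' fun p => imp_congr_left ?_
  have h1 : p ∈ vanishingIdeal ℂ (L.proj h '' L.Z h) ↔
      rename Sum.inr p ∈ vanishingIdeal ℂ (L.Z h) := by
    simp only [mem_vanishingIdeal_iff, Set.forall_mem_image, aeval_rename]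
    rfl
  have h2 : (aeval fun w => φ (X (Coord.toDVar L h (Sum.inr w)))) =
      (φ.comp (L.incl h)).comp (rename Sum.inr) := by
    ext w
    simp [incl]
  rw [h1, Z, IsPrime.vanishingIdeal_zeroLocus, hJ, RingHom.mem_ker, h2]
  rfl

/-- The Jacobian has full row rank on a dense open subset of `Z_h` iff it has full row rank at a
generic point `φ` of `Z_h`: both say that some maximal minor is not in `J_h`. -/
theorem jacobianFullRank_iff (h : Fin m → ℕ) [Fintype (L.SR h)] (φ : DPoly n m l →ₐ[ℂ] K)
    (hJ : L.J h = RingHom.ker (φ.comp (L.incl h))) :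
    L.JacobianFullRank h ↔
      (Matrix.of fun (P : L.SR h) (v : L.ParState h) =>
        φ (L.incl h (pderiv (Sum.inl v) P.1))).rank = Fintype.card (L.SR h) := by
  classical
  have hprime : (L.J h).IsPrime := hJ ▸ RingHom.ker_isPrime _
  let D : Matrix (L.SR h) (L.ParState h) (L.R h) := Matrix.of fun P v => pderiv (Sum.inl v) P.1
  have hD : ∀ p f, ((L.jacobian h p).submatrix id f).det = eval p (D.submatrix id f).det :=
    fun p f => (RingHom.map_det (eval p) (D.submatrix id f)).symm
  have hφ : ∀ f : L.SR h → L.ParState h, ((Matrix.of fun (P : L.SR h) (v : L.ParState h) =>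
        φ (L.incl h (pderiv (Sum.inl v) P.1))).submatrix id f).det = 0 ↔
      (D.submatrix id f).det ∈ L.J h := by
    intro f
    rw [hJ, RingHom.mem_ker, AlgHom.map_det]
    rfl
  have hcard : (L.S h).ncard = Fintype.card (L.SR h) := by
    rw [ncard_S, Nat.card_eq_fintype_card]
  rw [JacobianFullRank, Matrix.rank_eq_card_iff_exists_det_ne_zero]
  simp only [hcard, Matrix.rank_eq_card_iff_exists_det_ne_zero, hD, Ne, hφ]
  constructor
  · rintro ⟨U, -, hU, hdet⟩
    have hne : (U ∩ L.Z h).Nonempty := by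
      rw [Set.nonempty_iff_ne_empty]
      intro h0
      rw [h0, @closure_empty _ (zariski _), Set.subset_empty_iff] at hU
      have h1 := IsPrime.vanishingIdeal_zeroLocus (K := ℂ) (L.J h)
      rw [show zeroLocus ℂ (L.J h) = ∅ from hU, vanishingIdeal_empty] at h1
      exact hprime.ne_top h1.symm
    obtain ⟨p, hp⟩ := hne
    obtain ⟨f, hf⟩ := hdet p hp
    exact ⟨f, fun hmem => hf (hp.2 _ hmem)⟩
  · rintro ⟨f, hf⟩
    exact ⟨_, isOpen_zariski_eval_ne_zero _, zeroLocus_subset_closure_of_notMem _ hf,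
      fun p hp => ⟨f, hp.1⟩⟩

end LcmForm

theorem mainTheorem6 {n m l : ℕ} (M : DiffModel n m l) (L : LcmForm M) (h : Fin m → ℕ) :
    L.ProjDominant h ↔ L.JacobianFullRank h := by
  obtain ⟨lead, hT⟩ := L.exists_isTriangular h
  obtain ⟨φ, hQ, hφ⟩ := hT.exists_genericPoint
  have hJ : L.J h = RingHom.ker (φ.comp (L.incl h)) := by
    ext r
    exact (hφ _).symm
  have := (L.finite_SR h).fintype
  rw [L.projDominant_iff h φ hJ, L.jacobianFullRank_iff h φ hJ]
  exact hT.algebraicIndependent_iff_rank_jacobian (LcmForm.Coord.toDVar_injective L h)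
    (L.S_subset_range h) (T := L.SR h) (fun _ => Iff.rfl) φ hQ hφ
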